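/- A finite simple graph on at least two vertices is called a nut graph if its adjacency matrix has the eigenvalue $0$ with multiplicity $1$ and an eigenvector corresponding to $0$ has no zero entries. For a positive integer $n$ and a finite set $S$ of positive integers not exceeding $n/2$, let $\mathrm{Circ}(n,S)$ denote the circulant graph with vertex set $\{0,1,\dots,n-1\}$ in which $i$ is adjacent to $i\pm s$ (computed modulo $n$) for every vertex $i$ and every $s\in S$. For $t\geq 1$ let $S_t=\{1,\dots,2t+1\}\setminus\{t\}$. Theorem. For every odd integer $t\geq 3$ such that $t\not\equiv 1\pmod{10}$ and $t\not\equiv 15\pmod{18}$, the circulant graph $\mathrm{Circ}(n,S_t)$ is a nut graph for every even integer $n\geq 4t+4$. -/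

import Mathlib

/-- A finite simple graph is a nut graph if its (real) adjacency matrix has the eigenvalue `0` with
multiplicity one (the eigenspace of `0` has dimension one, which for a real symmetric matrix is also
the algebraic multiplicity), and an eigenvector for `0` has no zero entries. -/
def IsNutGraph {V : Type*} [Fintype V] [DecidableEq V] (G : SimpleGraph V)
    [DecidableRel G.Adj] : Prop :=
  Module.finrank ℝ (Module.End.eigenspace (Matrix.toLin' (G.adjMatrix ℝ)) 0) = 1 ∧
    ∃ x : V → ℝ, Module.End.HasEigenvector (Matrix.toLin' (G.adjMatrix ℝ)) 0 x ∧ ∀ v, x v ≠ 0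

/-- The circulant graph `Circ(n, S)`: the vertices are the residues modulo `n`, and distinct `i`, `j`
are adjacent exactly when `j ≡ i + s` or `j ≡ i - s` modulo `n` for some `s ∈ S`. -/
abbrev Circ (n : ℕ) (S : Finset ℕ) : SimpleGraph (ZMod n) :=
  SimpleGraph.circulantGraph (↑(S.image (fun s : ℕ => (s : ZMod n))) : Set (ZMod n))

/-- The generator set `S_t = {1, …, 2t+1} \ {t}`. -/
def almostConsecutive (t : ℕ) : Finset ℕ := Finset.Icc 1 (2 * t + 1) \ {t}

/-! The eigenvalues of the graph are λ(z) = ∑ (z^s + z⁻ˢ), with z an n-th root of unity. Times (z -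
1)z^(2t+1), λ(z) is a signed sum of eight powers of z (`sum_almostConsecutive`). It vanishes at z =
-1, whose eigenvector alternates in sign; the point is that no other z is a root
(`isNutGraph_circ`). If z has order m > 2, a vanishing sum of eight terms splits by exponents modulo
some Q with m ∣ 210Q (`exists_modulus_sum_filter_eq_zero`). No class is a singleton, which forces Q
to divide 3, 4, 5 or 7. The finitely many m left are checked in a finite field; the survivors are
the two excluded congruences. -/

/-- The positive part of the eight-term polynomial attached to `almostConsecutive t`, as a function
of `x = ζ ^ t` and `y = ζ`. -/
def plusTerms {R : Type*} [Semiring R] (x y : R) : R := x ^ 4 * y ^ 3 + x ^ 3 * y + x ^ 2 * y + x * y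

/-- The negative part of the eight-term polynomial attached to `almostConsecutive t`, as a function
of `x = ζ ^ t` and `y = ζ`. -/
def minusTerms {R : Type*} [Semiring R] (x y : R) : R :=
  x ^ 3 * y ^ 2 + x ^ 2 * y ^ 2 + x * y ^ 2 + 1

/-! ### Finite check modulo a prime -/

/-- Whether the eight-term polynomial is nonzero modulo `176401` at `(g ^ t, g)`, for all `t < k`
outside the exceptional pairs `(m, t)`. -/
def sieve (m g : ℕ) : ℕ → Bool
  | 0 => true
  | t + 1 => ((plusTerms (g ^ t % 176401) g % 176401 != minusTerms (g ^ t % 176401) g % 176401) ||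
      (m == 9 && t == 6) || (m == 10 && t == 1)) && sieve m g t

/-- The conjunction of `sieve m g m` over the divisors `m` of `N` with `2 ≤ m ≤ k`, where `g` is a
power of `529` of order `m` modulo `176401`. -/
def sieveAll (N : ℕ) : ℕ → Bool
  | 0 => true
  | m + 1 => ((N % (m + 1) != 0) || Nat.ble m 1 ||
      sieve (m + 1) (529 ^ (88200 / (m + 1)) % 176401) (m + 1)) && sieveAll N m

set_option maxRecDepth 100000 in
theorem sieveAll_840 : sieveAll 840 840 = true := by decide +kernel
set_option maxRecDepth 100000 in
theorem sieveAll_630 : sieveAll 630 630 = true := by decide +kernel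
set_option maxRecDepth 100000 in
theorem sieveAll_1050 : sieveAll 1050 1050 = true := by decide +kernel
set_option maxRecDepth 100000 in
theorem sieveAll_1470 : sieveAll 1470 1470 = true := by decide +kernel

theorem sieve_spec {m g k t : ℕ} (h : sieve m g k = true) (ht : t < k)
    (h9 : ¬ (m = 9 ∧ t = 6)) (h10 : ¬ (m = 10 ∧ t = 1)) :
    plusTerms ((g : ZMod 176401) ^ t) g ≠ minusTerms ((g : ZMod 176401) ^ t) g := by
  induction k with
  | zero => omega
  | succ k ih =>
    simp only [sieve, Bool.and_eq_true, Bool.or_eq_true, bne_iff_ne, beq_iff_eq] at h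
    obtain h' | h' := Nat.lt_succ_iff_lt_or_eq.1 ht
    · exact ih h.2 h'
    · subst h'
      intro he
      have h1 : plusTerms (g ^ t % 176401) g % 176401 ≠ minusTerms (g ^ t % 176401) g % 176401 := by tauto
      apply h1
      change _ ≡ _ [MOD 176401]
      rw [← ZMod.natCast_eq_natCast_iff]
      simp only [plusTerms, minusTerms] at he ⊢
      push_cast [ZMod.natCast_mod]
      exact he

theorem sieveAll_spec {N k m : ℕ} (h : sieveAll N k = true) (hm : 2 < m) (hmk : m ≤ k)
    (hmN : m ∣ N) : sieve m (529 ^ (88200 / m) % 176401) m = true := by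
  induction k with
  | zero => omega
  | succ k ih =>
    simp only [sieveAll, Bool.and_eq_true, Bool.or_eq_true, bne_iff_ne, Nat.ble_eq] at h
    obtain h' | h' := Nat.le_succ_iff.1 hmk
    · exact ih h.2 h'
    · subst h'
      have := Nat.mod_eq_zero_of_dvd hmN
      have h2 : ¬ k ≤ 1 := by omega
      tauto

/-- 176401 = 2 · 88200 + 1 and 88200 = lcm(840, 630, 1050, 1470), so the prime field has primitive
m-th roots of unity for every m to be checked. -/
theorem prime_176401 : Nat.Prime 176401 := by norm_num

theorem pow_529_eq_one_iff (k : ℕ) :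
    (529 : ZMod 176401) ^ k = 1 ↔ 529 ^ k % 176401 = 1 := by
  have h := ZMod.natCast_eq_natCast_iff (529 ^ k) 1 176401
  push_cast at h
  rw [h]
  rfl

theorem orderOf_529 : orderOf (529 : ZMod 176401) = 88200 := by
  apply orderOf_eq_of_pow_and_pow_div_prime (by norm_num)
  · rw [pow_529_eq_one_iff]
    decide +kernel
  · intro p hp hd
    have h : p ∣ 2 ^ 3 * 3 ^ 2 * 5 ^ 2 * 7 ^ 2 := by simpa using hd
    have : p = 2 ∨ p = 3 ∨ p = 5 ∨ p = 7 := by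
      have aux : ∀ {q k : ℕ}, q.Prime → p ∣ q ^ k → p = q := fun hq hh =>
        (Nat.prime_dvd_prime_iff_eq hp hq).1 (hp.dvd_of_dvd_pow hh)
      rcases hp.dvd_mul.1 h with h | h
      · rcases hp.dvd_mul.1 h with h | h
        · rcases hp.dvd_mul.1 h with h | h
          · exact .inl (aux (by norm_num) h)
          · exact .inr (.inl (aux (by norm_num) h))
        · exact .inr (.inr (.inl (aux (by norm_num) h)))
      · exact .inr (.inr (.inr (aux (by norm_num) h)))
    rcases this with rfl | rfl | rfl | rfl <;> rw [Ne, pow_529_eq_one_iff] <;> decide +kernel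

-- If the integer polynomial vanishes at ζ, the m-th cyclotomic polynomial divides it, so it also
-- vanishes at a primitive m-th root modulo 176401, which the sieve rules out.
open Polynomial in
theorem plusTerms_ne_minusTerms_of_dvd {ζ : ℂ} {m t : ℕ} (hζ : IsPrimitiveRoot ζ m) (hm : 2 < m)
    (hdvd : m ∣ 840 ∨ m ∣ 630 ∨ m ∣ 1050 ∨ m ∣ 1470)
    (h9 : ¬ (m = 9 ∧ t % m = 6)) (h10 : ¬ (m = 10 ∧ t % m = 1)) :
    plusTerms (ζ ^ t) ζ ≠ minusTerms (ζ ^ t) ζ := by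
  intro he
  have : Fact (Nat.Prime 176401) := ⟨prime_176401⟩
  have hm0 : 0 < m := by omega
  have hmM : m ∣ 88200 := by
    rcases hdvd with h | h | h | h <;> exact h.trans (by norm_num)
  have hs : sieve m (529 ^ (88200 / m) % 176401) m = true := by
    rcases hdvd with h | h | h | h
    · exact sieveAll_spec sieveAll_840 hm (Nat.le_of_dvd (by norm_num) h) h
    · exact sieveAll_spec sieveAll_630 hm (Nat.le_of_dvd (by norm_num) h) h
    · exact sieveAll_spec sieveAll_1050 hm (Nat.le_of_dvd (by norm_num) h) h
    · exact sieveAll_spec sieveAll_1470 hm (Nat.le_of_dvd (by norm_num) h) h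
  have key := sieve_spec hs (Nat.mod_lt t hm0) h9 h10
  push_cast [ZMod.natCast_mod] at key
  set g : ZMod 176401 := 529 ^ (88200 / m) with hg
  have hgprim : IsPrimitiveRoot g m := by
    have h0 : IsPrimitiveRoot (529 : ZMod 176401) 88200 := by
      rw [← orderOf_529]; exact IsPrimitiveRoot.orderOf _
    exact h0.pow (by norm_num) (Nat.div_mul_cancel hmM).symm
  let F : ℤ[X] := plusTerms (X ^ t) X - minusTerms (X ^ t) X
  have hF : aeval ζ F = 0 := by
    simp only [F, plusTerms, minusTerms, map_sub, map_add, map_mul, map_pow, aeval_X, map_one] at he ⊢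
    exact sub_eq_zero.2 he
  have hdiv : cyclotomic m ℤ ∣ F := by
    rw [cyclotomic_eq_minpoly hζ hm0]
    exact minpoly.isIntegrallyClosed_dvd (hζ.isIntegral hm0) hF
  have hroot : aeval g (cyclotomic m ℤ) = 0 := by
    rw [aeval_def, eval₂_eq_eval_map, map_cyclotomic]
    have : NeZero m := ⟨hm0.ne'⟩
    have : NeZero (m : ZMod 176401) := hgprim.neZero'
    exact (isRoot_cyclotomic_iff.2 hgprim)
  have hFg : aeval g F = 0 := by
    obtain ⟨G, hG⟩ := hdiv
    rw [hG, map_mul, hroot, zero_mul]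
  simp only [F, plusTerms, minusTerms, map_sub, map_add, map_mul, map_pow, aeval_X, map_one] at hFg
  apply key
  have hpow : g ^ (t % m) = g ^ t := by
    conv_lhs => rw [hgprim.eq_orderOf, pow_mod_orderOf]
  rw [hpow]
  exact sub_eq_zero.1 hFg

/-! ### Splitting vanishing sums of roots of unity -/

open Polynomial in
theorem IsPrimitiveRoot.sum_pow_eq_zero_of_coprime {ι : Type*} {ζ : ℂ} {m : ℕ} (hm : 0 < m)
    (hζ : IsPrimitiveRoot ζ m) {S : Finset ι} {a : ι → ℤ} {e : ι → ℕ}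
    (h : ∑ i ∈ S, (a i : ℂ) * ζ ^ e i = 0) {k : ℕ} (hk : k.Coprime m) :
    ∑ i ∈ S, (a i : ℂ) * (ζ ^ k) ^ e i = 0 := by
  let F : ℤ[X] := ∑ i ∈ S, C (a i) * X ^ e i
  have hF : ∀ z : ℂ, aeval z F = ∑ i ∈ S, (a i : ℂ) * z ^ e i := fun z => by
    simp [F, map_sum]
  have h1 : minpoly ℤ ζ ∣ F :=
    minpoly.isIntegrallyClosed_dvd (hζ.isIntegral hm) ((hF ζ).trans h)
  rw [hζ.minpoly_eq_pow_coprime hk] at h1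
  obtain ⟨G, hG⟩ := h1
  rw [← hF, hG, map_mul, minpoly.aeval, zero_mul]

/-- Fourier inversion on ℤ/p isolates one residue class of exponents. -/
theorem IsPrimitiveRoot.sum_pow_filter_mod {ι : Type*} {ω : ℂ} {p : ℕ} (hp : 0 < p)
    (hω : IsPrimitiveRoot ω p) (S : Finset ι) (c : ι → ℂ) (e : ι → ℕ) (r : ℕ) :
    ∑ k ∈ Finset.range p, (ω⁻¹ ^ r) ^ k * ∑ i ∈ S, c i * (ω ^ k) ^ e i =
      p * ∑ i ∈ S with e i % p = r % p, c i := by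
  have hω0 : ω ≠ 0 := hω.ne_zero hp.ne'
  have hpow : ∀ j : ℕ, ω ^ j = ω ^ (j % p) := fun j => by
    conv_rhs => rw [hω.eq_orderOf, pow_mod_orderOf]
  simp_rw [Finset.mul_sum]
  rw [Finset.sum_comm, Finset.sum_filter]
  refine Finset.sum_congr rfl fun i _ => ?_
  have hterm : ∀ k : ℕ, (ω⁻¹ ^ r) ^ k * (c i * (ω ^ k) ^ e i) =
      c i * (ω ^ e i / ω ^ r) ^ k := fun k => by
    rw [div_pow, inv_pow, inv_pow, ← pow_mul ω k, ← pow_mul ω (e i), mul_comm k]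
    field_simp
  simp_rw [hterm]
  rw [← Finset.mul_sum]
  split_ifs with h
  · have : ω ^ e i / ω ^ r = 1 := by
      rw [hpow (e i), h, ← hpow r, div_self (pow_ne_zero _ hω0)]
    simp [this, mul_comm]
  · have hne : ω ^ e i / ω ^ r ≠ 1 := fun h1 => h <| by
      rw [div_eq_one_iff_eq (pow_ne_zero _ hω0), hpow (e i), hpow r] at h1
      exact hω.pow_inj (Nat.mod_lt _ hp) (Nat.mod_lt _ hp) h1
    have h1 : (ω ^ e i / ω ^ r) ^ p = 1 := by
      rw [div_pow, ← pow_mul, ← pow_mul, mul_comm, mul_comm r, pow_mul, pow_mul, hω.pow_eq_one]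
      simp
    rw [geom_sum_eq hne, h1]
    simp

/-- A vanishing sum of roots of unity of order `m` splits according to the exponents modulo a prime
`p ∣ m`, provided that `p ^ 2 ∣ m` or the sum has fewer than `p` terms. -/
theorem IsPrimitiveRoot.sum_filter_mod_prime_eq_zero {ι : Type*} {ζ : ℂ} {m p : ℕ} (hm : 0 < m)
    (hζ : IsPrimitiveRoot ζ m) (hp : p.Prime) (hpm : p ∣ m) {S : Finset ι}
    (hS : p ^ 2 ∣ m ∨ S.card < p) {a : ι → ℤ} {e : ι → ℕ}
    (h : ∑ i ∈ S, (a i : ℂ) * ζ ^ e i = 0) (r : ℕ) :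
    ∑ i ∈ S with e i % p = r % p, (a i : ℂ) * ζ ^ e i = 0 := by
  obtain ⟨N, rfl⟩ := hpm
  have hω : IsPrimitiveRoot (ζ ^ N) p := hζ.pow hm (mul_comm _ _)
  have hp0 : (p : ℂ) ≠ 0 := by exact_mod_cast hp.ne_zero
  have hF := fun r => hω.sum_pow_filter_mod hp.pos S (fun i => (a i : ℂ) * ζ ^ e i) e r
  -- Here ζ · (ζ^N)^k = ζ^(1 + kN) is a conjugate of ζ.
  have hcop : ∀ k, ¬ p ∣ 1 + k * N →
      ∑ i ∈ S, (a i : ℂ) * ζ ^ e i * ((ζ ^ N) ^ k) ^ e i = 0 := fun k hk => by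
    have hc : (1 + k * N).Coprime (p * N) := by
      refine Nat.Coprime.mul_right ((hp.coprime_iff_not_dvd.2 hk).symm) ?_
      simp
    have := hζ.sum_pow_eq_zero_of_coprime hm h hc
    rw [← this]
    refine Finset.sum_congr rfl fun i _ => ?_
    rw [mul_assoc, ← mul_pow]
    congr 2
    ring
  suffices hall : ∀ k < p, ∑ i ∈ S, (a i : ℂ) * ζ ^ e i * ((ζ ^ N) ^ k) ^ e i = 0 by
    have h0 := hF r
    rw [Finset.sum_eq_zero fun k hk => by rw [hall k (Finset.mem_range.1 hk), mul_zero]] at h0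
    exact (mul_eq_zero.1 h0.symm).resolve_left hp0
  by_contra! hbad
  obtain ⟨k, hkp, hk⟩ := hbad
  have hdk : p ∣ 1 + k * N := by
    by_contra hcon
    exact hk (hcop k hcon)
  have hpN : ¬ p ∣ N := fun hcon =>
    hp.one_lt.ne' (Nat.dvd_one.1 ((Nat.dvd_add_left (hcon.mul_left k)).1 hdk))
  have hcard : S.card < p := hS.resolve_left fun h2 => hpN <| by
    rw [pow_two] at h2
    exact Nat.dvd_of_mul_dvd_mul_left hp.pos h2
  -- With fewer than p terms some class s is empty; inversion at s leaves only the bad k, whose sum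
  -- therefore vanishes too.
  obtain ⟨s, hs⟩ : ∃ s, ∀ i ∈ S, e i % p ≠ s % p := by
    have : (S.image fun i => e i % p).card < (Finset.range p).card := by
      simpa using Finset.card_image_le.trans_lt hcard
    obtain ⟨s, hs, hs'⟩ := Finset.exists_mem_notMem_of_card_lt_card this
    refine ⟨s, fun i hi hcon => hs' (Finset.mem_image.2 ⟨i, hi, ?_⟩)⟩
    rw [hcon, Nat.mod_eq_of_lt (Finset.mem_range.1 hs)]
  have h0 := hF s
  rw [Finset.filter_false_of_mem hs, Finset.sum_empty, mul_zero,
    Finset.sum_eq_single_of_mem k (Finset.mem_range.2 hkp)] at h0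
  · have hζ0 : ζ ≠ 0 := hζ.ne_zero hm.ne'
    refine hk ((mul_eq_zero.1 h0).resolve_left ?_)
    simp [hζ0]
  · intro j hj hjk
    rw [hcop j, mul_zero]
    intro hdj
    apply hjk
    have hmod : 1 + j * N ≡ 1 + k * N [MOD p] :=
      ((Nat.modEq_zero_iff_dvd.2 hdj).trans (Nat.modEq_zero_iff_dvd.2 hdk).symm)
    have := Nat.ModEq.cancel_right_of_coprime ((hp.coprime_iff_not_dvd.2 hpN))
      (Nat.ModEq.add_left_cancel' 1 hmod)
    exact this.eq_of_lt_of_lt (Finset.mem_range.1 hj) hkp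

/-- 210 is the product of the primes below 8, the number of terms. -/
theorem exists_prime_of_not_dvd_210 {m : ℕ} (h : ¬ m ∣ 210) :
    ∃ p, p.Prime ∧ p ∣ m ∧ (p ^ 2 ∣ m ∨ 8 < p) := by
  by_contra! hcon
  apply h
  have hsq : Squarefree m := by
    rw [Nat.squarefree_iff_prime_squarefree]
    intro p hp hpp
    rw [← pow_two] at hpp
    exact (hcon p hp ((dvd_pow_self p two_ne_zero).trans hpp)).1 hpp
  rw [← Nat.prod_primeFactors_of_squarefree hsq]
  have hsub : m.primeFactors ⊆ {2, 3, 5, 7} := by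
    intro p hp
    have hpp := Nat.prime_of_mem_primeFactors hp
    have := (hcon p hpp (Nat.dvd_of_mem_primeFactors hp)).2
    interval_cases p <;> revert hpp <;> norm_num
  have := Finset.prod_dvd_prod_of_subset _ _ (fun p => p) hsub
  simpa using this

/-- A vanishing sum of at most eight roots of unity of order `m` splits according to the exponents
modulo a divisor `Q` of `m` with `m / Q` dividing `210`. -/
theorem exists_modulus_sum_filter_eq_zero {ι : Type*} (m : ℕ) (hm : 0 < m) :
    ∃ Q, Q ∣ m ∧ m ∣ Q * 210 ∧ ∀ (ζ : ℂ), IsPrimitiveRoot ζ m → ∀ (S : Finset ι), S.card ≤ 8 →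
      ∀ (a : ι → ℤ) (e : ι → ℕ), ∑ i ∈ S, (a i : ℂ) * ζ ^ e i = 0 →
        ∀ r, ∑ i ∈ S with e i % Q = r % Q, (a i : ℂ) * ζ ^ e i = 0 := by
  induction m using Nat.strong_induction_on with
  | _ m ih =>
  by_cases h210 : m ∣ 210
  · refine ⟨1, one_dvd _, by simpa using h210, fun ζ _ S _ a e h r => ?_⟩
    simpa [Nat.mod_one] using h
  obtain ⟨p, hp, ⟨N, rfl⟩, hpm⟩ := exists_prime_of_not_dvd_210 h210
  have hN : 0 < N := Nat.pos_of_mul_pos_left hm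
  obtain ⟨Q, hQN, hNQ, hQ⟩ := ih N (by nlinarith [hp.two_le]) hN
  refine ⟨p * Q, Nat.mul_dvd_mul_left p hQN, by
    rw [mul_assoc]; exact Nat.mul_dvd_mul_left p hNQ, fun ζ hζ S hS a e h r => ?_⟩
  have hζ0 : ζ ≠ 0 := hζ.ne_zero hm.ne'
  have h1 := hζ.sum_filter_mod_prime_eq_zero hm hp (dvd_mul_right p N)
    (hpm.imp_right fun h8 => hS.trans_lt h8) h r
  -- Within a class modulo p, a common power of ζ factors out, leaving a sum in ζ^p, of order N.
  have hsplit : ∀ i, e i % p = r % p → ζ ^ e i = ζ ^ (r % p) * (ζ ^ p) ^ (e i / p) :=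
    fun i hi => by rw [← hi, ← pow_mul, ← pow_add, Nat.mod_add_div]
  have h2 : ∑ i ∈ S with e i % p = r % p, (a i : ℂ) * (ζ ^ p) ^ (e i / p) = 0 := by
    have : ζ ^ (r % p) * ∑ i ∈ S with e i % p = r % p, (a i : ℂ) * (ζ ^ p) ^ (e i / p) = 0 := by
      rw [← h1, Finset.mul_sum]
      refine Finset.sum_congr rfl fun i hi => ?_
      rw [hsplit i (Finset.mem_filter.1 hi).2]
      ring
    exact (mul_eq_zero.1 this).resolve_left (pow_ne_zero _ hζ0)
  have h3 := hQ (ζ ^ p) (hζ.pow hm rfl) _ ((Finset.card_filter_le _ _).trans hS) a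
    (fun i => e i / p) h2 (r / p)
  rw [Finset.filter_filter] at h3
  have hiff : ∀ i, (e i % p = r % p ∧ e i / p % Q = r / p % Q) ↔ e i % (p * Q) = r % (p * Q) := by
    intro i
    rw [Nat.mod_mul, Nat.mod_mul]
    constructor
    · rintro ⟨h, h'⟩
      rw [h, h']
    · intro h
      have hmod := congrArg (· % p) h
      simp only [Nat.add_mul_mod_self_left, Nat.mod_mod] at hmod
      rw [hmod] at h
      exact ⟨hmod, Nat.eq_of_mul_eq_mul_left hp.pos (Nat.add_left_cancel h)⟩
  rw [← mul_zero (ζ ^ (r % p)), ← h3, Finset.mul_sum]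
  refine Finset.sum_congr (Finset.filter_congr fun i _ => (hiff i).symm) fun i hi => ?_
  rw [hsplit i ((Finset.mem_filter.1 hi).2.1)]
  ring

/-! ### Roots of unity annihilating the eight-term polynomial -/

/-- The exponents of the eight-term polynomial. -/
def termExponent (t : ℕ) : Fin 8 → ℕ :=
  ![4 * t + 3, 3 * t + 1, 2 * t + 1, t + 1, 3 * t + 2, 2 * t + 2, t + 2, 0]

/-- The coefficients of the eight-term polynomial. -/
def termCoeff : Fin 8 → ℤ := ![1, 1, 1, 1, -1, -1, -1, -1]

theorem sum_termCoeff_mul_pow (z : ℂ) (t : ℕ) :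
    ∑ i, (termCoeff i : ℂ) * z ^ termExponent t i =
      plusTerms (z ^ t) z - minusTerms (z ^ t) z := by
  simp [Fin.sum_univ_eight, termCoeff, termExponent, plusTerms, minusTerms]
  ring

theorem modulus_of_congruences {Q t : ℕ}
    (h : ∀ i, ∃ j, j ≠ i ∧ termExponent t j ≡ termExponent t i [MOD Q]) :
    Q ∣ 4 ∨ Q ∣ 3 ∨ Q ∣ 5 ∨ Q ∣ 7 := by
  have h' : ∀ i, ∃ j, j ≠ i ∧ (termExponent t j : ZMod Q) = (termExponent t i : ZMod Q) :=
    fun i => (h i).imp fun j hj => ⟨hj.1, (ZMod.natCast_eq_natCast_iff _ _ _).2 hj.2⟩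
  -- Partners for the exponents 0, 2t + 2, 3t + 2 and 3t + 1 already suffice.
  have hz := h' 7
  have hc := h' 5
  have hb := h' 4
  have hb' := h' 1
  simp only [Fin.exists_fin_succ, Fin.exists_fin_zero, termExponent] at hz hc hb hb'
  simp [Fin.ext_iff] at hz hc hb hb'
  have hd : ∀ k : ℕ, Q ∣ k ↔ (k : ZMod Q) = 0 := fun k => (ZMod.natCast_eq_zero_iff _ _).symm
  rw [hd, hd, hd, hd]
  push_cast
  clear h h' hd
  generalize (t : ZMod Q) = τ at *
  by_cases h21 : (2 : ZMod Q) = 1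
  · exact .inl (by linear_combination 4 * h21)
  simp only [h21, Ne.symm h21, false_or] at hc hb hb'
  grind (splits := 40)

theorem IsPrimitiveRoot.eq_of_plusTerms_eq_minusTerms {ζ : ℂ} {m t : ℕ}
    (hζ : IsPrimitiveRoot ζ m) (hm : 2 < m) (h : plusTerms (ζ ^ t) ζ = minusTerms (ζ ^ t) ζ) :
    m = 9 ∧ t % m = 6 ∨ m = 10 ∧ t % m = 1 := by
  have hm0 : 0 < m := by omega
  obtain ⟨Q, -, hmQ, hQ⟩ := exists_modulus_sum_filter_eq_zero (ι := Fin 8) m hm0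
  have hsum := hQ ζ hζ Finset.univ (by simp) termCoeff (termExponent t)
    (by rw [sum_termCoeff_mul_pow, h, sub_self])
  have hmod : Q ∣ 4 ∨ Q ∣ 3 ∨ Q ∣ 5 ∨ Q ∣ 7 := by
    apply modulus_of_congruences (t := t)
    intro i
    by_contra! hcon
    have hi := hsum (termExponent t i)
    have hfilter :
        Finset.univ.filter (fun j => termExponent t j % Q = termExponent t i % Q) = {i} := by
      ext j
      simp only [Finset.mem_filter, Finset.mem_univ, true_and, Finset.mem_singleton]
      refine ⟨fun hj => ?_, fun hj => by rw [hj]⟩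
      by_contra hji
      exact hcon j hji hj
    rw [hfilter, Finset.sum_singleton] at hi
    have hc : (termCoeff i : ℂ) ≠ 0 := by
      have : ∀ k, termCoeff k ≠ 0 := by decide
      exact_mod_cast this i
    exact mul_ne_zero hc (pow_ne_zero _ (hζ.ne_zero hm0.ne')) hi
  have hdvd : m ∣ 840 ∨ m ∣ 630 ∨ m ∣ 1050 ∨ m ∣ 1470 := by
    refine hmod.imp ?_ (Or.imp ?_ (Or.imp ?_ ?_)) <;>
      exact fun hh => hmQ.trans (Nat.mul_dvd_mul_right hh 210)
  by_contra! hcon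
  exact plusTerms_ne_minusTerms_of_dvd hζ hm hdvd (fun hh => hcon.1 hh.1 hh.2)
    (fun hh => hcon.2 hh.1 hh.2) h

/-! ### Closed form of the eigenvalues -/

theorem mem_almostConsecutive {t s : ℕ} :
    s ∈ almostConsecutive t ↔ 1 ≤ s ∧ s ≤ 2 * t + 1 ∧ s ≠ t := by
  simp [almostConsecutive, and_assoc]

theorem sum_Icc_pow_add_inv_pow {K : Type*} [Field K] {z : K} (hz : z ≠ 0) (N : ℕ) :
    (z - 1) * z ^ N * ∑ s ∈ Finset.Icc 1 N, (z ^ s + z⁻¹ ^ s) =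
      z ^ (2 * N + 1) - z ^ (N + 1) + z ^ N - 1 := by
  induction N with
  | zero => simp
  | succ N ih =>
    rw [Finset.sum_Icc_succ_top (by omega)]
    have h : z ^ (N + 1) * z⁻¹ ^ (N + 1) = 1 := by
      rw [← mul_pow, mul_inv_cancel₀ hz, one_pow]
    linear_combination z * ih + (z - 1) * h

theorem sum_almostConsecutive {K : Type*} [Field K] {z : K} (hz : z ≠ 0) {t : ℕ} (ht : 1 ≤ t) :
    (z - 1) * z ^ (2 * t + 1) * ∑ s ∈ almostConsecutive t, (z ^ s + z⁻¹ ^ s) =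
      plusTerms (z ^ t) z - minusTerms (z ^ t) z := by
  have h1 := sum_Icc_pow_add_inv_pow hz (2 * t + 1)
  have h2 : ∑ s ∈ almostConsecutive t, (z ^ s + z⁻¹ ^ s) + (z ^ t + z⁻¹ ^ t) =
      ∑ s ∈ Finset.Icc 1 (2 * t + 1), (z ^ s + z⁻¹ ^ s) := by
    have := Finset.sum_sdiff (f := fun s => z ^ s + z⁻¹ ^ s)
      (show {t} ⊆ Finset.Icc 1 (2 * t + 1) by simp; omega)
    rw [← this, Finset.sum_singleton, almostConsecutive]
  have h : z ^ t * z⁻¹ ^ t = 1 := by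
    rw [← mul_pow, mul_inv_cancel₀ hz, one_pow]
  simp only [plusTerms, minusTerms]
  rw [← h2] at h1
  linear_combination h1 - (z - 1) * z ^ (t + 1) * h

/-! ### Cyclic shift and adjacency operator -/

section Shift

variable (n : ℕ)

/-- The cyclic shift operator on real functions on `ZMod n`. -/
def cyclicShift : Module.End ℝ (ZMod n → ℝ) := LinearMap.funLeft ℝ ℝ (· + 1)

theorem cyclicShift_apply (x : ZMod n → ℝ) (i : ZMod n) : cyclicShift n x i = x (i + 1) := rfl

theorem cyclicShift_pow_apply (k : ℕ) (x : ZMod n → ℝ) (i : ZMod n) :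
    (cyclicShift n ^ k) x i = x (i + k) := by
  induction k generalizing i with
  | zero => simp
  | succ k ih =>
    rw [pow_succ', Module.End.mul_apply, cyclicShift_apply, ih]
    push_cast
    ring_nf

theorem eq_smul_of_cyclicShift_eq_neg [NeZero n] {x v : ZMod n → ℝ} (hx : cyclicShift n x = -x)
    (hv : cyclicShift n v = -v) (hv0 : v 0 = 1) : x = x 0 • v := by
  have key : ∀ k : ℕ, x k = x 0 * v k := by
    intro k
    induction k with
    | zero => simp [hv0]
    | succ k ih =>
      have h1 := congrFun hx k
      have h2 := congrFun hv k
      simp only [cyclicShift_apply, Pi.neg_apply] at h1 h2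
      push_cast
      rw [h1, h2, ih]
      ring
  ext i
  simpa using key i.val

/-- The alternating function `i ↦ (-1) ^ i` on `ZMod n`, for even `n`. -/
def alternating (hn : 2 ∣ n) (i : ZMod n) : ℝ := if ZMod.castHom hn (ZMod 2) i = 0 then 1 else -1

theorem alternating_ne_zero (hn : 2 ∣ n) (i : ZMod n) : alternating n hn i ≠ 0 := by
  unfold alternating
  split_ifs <;> norm_num

theorem cyclicShift_alternating (hn : 2 ∣ n) :
    cyclicShift n (alternating n hn) = -alternating n hn := by
  ext i
  rw [cyclicShift_apply, Pi.neg_apply, alternating, alternating, map_add, map_one]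
  have h : ∀ a : ZMod 2, a + 1 = 0 ↔ a ≠ 0 := by decide
  simp only [h, ne_eq, ite_not]
  split_ifs <;> norm_num

end Shift

open Polynomial in
/-- The polynomial in the cyclic shift representing the adjacency operator of `Circ n S`. -/
noncomputable def circPolynomial (n : ℕ) (S : Finset ℕ) : ℝ[X] :=
  ∑ s ∈ S, (X ^ s + X ^ (n - s))

open Polynomial in
theorem aeval_circPolynomial {n : ℕ} {S : Finset ℕ} (hS : ∀ s ∈ S, s ≤ n) {K : Type*} [Field K]
    [Algebra ℝ K] {z : K} (hz : z ^ n = 1) (hz0 : z ≠ 0) :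
    aeval z (circPolynomial n S) = ∑ s ∈ S, (z ^ s + z⁻¹ ^ s) := by
  simp only [circPolynomial, map_sum, map_add, map_pow, aeval_X]
  refine Finset.sum_congr rfl fun s hs => ?_
  rw [pow_sub₀ z hz0 (hS s hs), hz, one_mul, inv_pow]

theorem circ_neighborFinset {n : ℕ} [NeZero n] {S : Finset ℕ}
    (hS : ∀ s ∈ S, 1 ≤ s ∧ 2 * s < n) [DecidableRel (Circ n S).Adj] (i : ZMod n) :
    (Circ n S).neighborFinset i =
      S.image (fun s : ℕ => i + s) ∪ S.image (fun s : ℕ => i - s) := by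
  have hs0 : ∀ s ∈ S, (s : ZMod n) ≠ 0 := fun s hs h => by
    rw [ZMod.natCast_eq_zero_iff] at h
    have := Nat.le_of_dvd (hS s hs).1 h
    have := hS s hs
    omega
  ext j
  simp only [SimpleGraph.mem_neighborFinset, SimpleGraph.circulantGraph_adj, Finset.coe_image,
    Set.mem_image, Finset.mem_coe, Finset.mem_union, Finset.mem_image]
  constructor
  · rintro ⟨-, ⟨s, hs, h⟩ | ⟨s, hs, h⟩⟩
    · exact .inr ⟨s, hs, by rw [h]; ring⟩
    · exact .inl ⟨s, hs, by rw [h]; ring⟩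
  · rintro (⟨s, hs, rfl⟩ | ⟨s, hs, rfl⟩)
    · exact ⟨fun h => hs0 s hs (by simpa using h), .inr ⟨s, hs, by ring⟩⟩
    · exact ⟨fun h => hs0 s hs (by linear_combination h), .inl ⟨s, hs, by ring⟩⟩

/-- Since 2s < n, the residues ±s are pairwise distinct, so no neighbour is counted twice. -/
theorem sum_circ_neighborFinset {n : ℕ} [NeZero n] {S : Finset ℕ}
    (hS : ∀ s ∈ S, 1 ≤ s ∧ 2 * s < n) [DecidableRel (Circ n S).Adj] (x : ZMod n → ℝ)
    (i : ZMod n) :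
    ∑ j ∈ (Circ n S).neighborFinset i, x j = ∑ s ∈ S, (x (i + s) + x (i - s)) := by
  have hinj : ∀ s ∈ S, ∀ s' ∈ S, (s : ZMod n) = s' → s = s' := fun s hs s' hs' h => by
    rw [ZMod.natCast_eq_natCast_iff] at h
    have := hS s hs
    have := hS s' hs'
    exact h.eq_of_lt_of_lt (by omega) (by omega)
  rw [circ_neighborFinset hS, Finset.sum_union, Finset.sum_image, Finset.sum_image,
    Finset.sum_add_distrib]
  · exact fun s hs s' hs' h => hinj s hs s' hs' (sub_right_injective h)
  · exact fun s hs s' hs' h => hinj s hs s' hs' (add_right_injective i h)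
  · rw [Finset.disjoint_left]
    intro j hj hj'
    obtain ⟨s, hs, rfl⟩ := Finset.mem_image.1 hj
    obtain ⟨s', hs', h⟩ := Finset.mem_image.1 hj'
    have h0 : ((s + s' : ℕ) : ZMod n) = 0 := by
      push_cast
      linear_combination -h
    rw [ZMod.natCast_eq_zero_iff] at h0
    have h1 := hS s hs
    have h2 := hS s' hs'
    have := Nat.le_of_dvd (by omega) h0
    omega

open Polynomial in
theorem aeval_cyclicShift_circPolynomial {n : ℕ} [NeZero n] {S : Finset ℕ}
    (hS : ∀ s ∈ S, 1 ≤ s ∧ 2 * s < n) [DecidableRel (Circ n S).Adj] :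
    aeval (cyclicShift n) (circPolynomial n S) =
      Matrix.toLin' ((Circ n S).adjMatrix ℝ) := by
  refine LinearMap.ext fun x => funext fun i => ?_
  rw [Matrix.toLin'_apply, SimpleGraph.adjMatrix_mulVec_apply, sum_circ_neighborFinset hS]
  simp only [circPolynomial, map_sum, map_add, map_pow, aeval_X, LinearMap.sum_apply,
    LinearMap.add_apply, Finset.sum_apply, Pi.add_apply, cyclicShift_pow_apply]
  refine Finset.sum_congr rfl fun s hs => ?_
  have hsn : s ≤ n := by have := hS s hs; omega
  rw [Nat.cast_sub hsn, ZMod.natCast_self, zero_sub, ← sub_eq_add_neg]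

-- Write X^n - 1 = (X + 1)R and let P be the circulant polynomial. As R and P share no complex root,
-- the kernel of P(T) lies in that of T + 1, a line.
open Polynomial in
theorem isNutGraph_circ {n : ℕ} [NeZero n] (hn : 2 ∣ n) {S : Finset ℕ}
    (hS : ∀ s ∈ S, 1 ≤ s ∧ 2 * s < n) [DecidableRel (Circ n S).Adj]
    (hneg : ∑ s ∈ S, ((-1 : ℝ) ^ s + (-1 : ℝ)⁻¹ ^ s) = 0)
    (hne : ∀ z : ℂ, z ^ n = 1 → z ≠ -1 → ∑ s ∈ S, (z ^ s + z⁻¹ ^ s) ≠ 0) :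
    IsNutGraph (Circ n S) := by
  have hn0 : n ≠ 0 := NeZero.ne n
  have hSn : ∀ s ∈ S, s ≤ n := fun s hs => by have := hS s hs; omega
  set T := cyclicShift n with hT
  set v := alternating n hn with hv
  have hv0 : v ≠ 0 := fun h => alternating_ne_zero n hn 0 (congrFun h 0)
  have hTv : T v = -v := cyclicShift_alternating n hn
  have hA : aeval T (circPolynomial n S) = Matrix.toLin' ((Circ n S).adjMatrix ℝ) :=
    aeval_cyclicShift_circPolynomial hS
  have hTn : T ^ n = 1 := by
    refine LinearMap.ext fun x => funext fun i => ?_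
    rw [hT, cyclicShift_pow_apply]
    simp
  have hAv : Matrix.toLin' ((Circ n S).adjMatrix ℝ) v = 0 := by
    have hev : T.HasEigenvector (-1) v := by
      rw [Module.End.hasEigenvector_iff, Module.End.mem_eigenspace_iff]
      exact ⟨by rw [hTv, neg_one_smul], hv0⟩
    rw [← hA, Module.End.aeval_apply_of_hasEigenvector hev]
    have h1 := aeval_circPolynomial hSn (K := ℝ) (z := -1)
      ((even_iff_two_dvd.2 hn).neg_one_pow) (by norm_num)
    rw [coe_aeval_eq_eval, hneg] at h1
    rw [h1, zero_smul]
  obtain ⟨R, hR⟩ : (X - C (-1 : ℝ)) ∣ X ^ n - 1 := by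
    rw [dvd_iff_isRoot]
    simp [(even_iff_two_dvd.2 hn).neg_one_pow]
  have hcop : IsCoprime R (circPolynomial n S) := by
    rw [isCoprime_iff_aeval_ne_zero_of_isAlgClosed ℝ ℂ]
    intro z
    by_contra! hcon
    have hzn : z ^ n = 1 := by
      have := congrArg (aeval z) hR
      rw [map_mul, hcon.1, mul_zero] at this
      simpa [sub_eq_zero] using this
    have hz0 : z ≠ 0 := by
      rintro rfl
      simp [hn0] at hzn
    by_cases hz : z = -1
    -- -1 is a simple root of X^n - 1, so R(-1) ≠ 0.
    · have hder := congrArg (fun p => aeval z (derivative p)) hR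
      rw [hz] at hcon
      simp [hz, hcon.1, derivative_X_pow, hn0] at hder
    · exact hne z hzn hz (by rw [← aeval_circPolynomial hSn hzn hz0, hcon.2])
  obtain ⟨a, b, hab⟩ := hcop
  have hspan : ∀ x, Matrix.toLin' ((Circ n S).adjMatrix ℝ) x = 0 → x = x 0 • v := by
    intro x hx
    rw [← hA] at hx
    refine eq_smul_of_cyclicShift_eq_neg n ?_ hTv (by simp [hv, alternating])
    -- Bézout times X + 1: at T, both terms on the right kill x.
    have hid : X + 1 = a * (X ^ n - 1) + (X + 1) * b * circPolynomial n S := by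
      rw [hR]
      simp only [map_neg, map_one]
      linear_combination -(X + 1) * hab
    have := congrArg (fun p => aeval T p x) hid
    simp [hTn, Module.End.mul_apply, hx] at this
    exact eq_neg_of_add_eq_zero_left this
  have hmem : ∀ x, x ∈ Module.End.eigenspace (Matrix.toLin' ((Circ n S).adjMatrix ℝ)) 0 ↔
      Matrix.toLin' ((Circ n S).adjMatrix ℝ) x = 0 := fun x => by
    rw [Module.End.mem_eigenspace_iff, zero_smul]
  refine ⟨?_, v, ⟨(hmem v).2 hAv, hv0⟩, alternating_ne_zero n hn⟩
  refine finrank_eq_one (⟨v, (hmem v).2 hAv⟩ : Module.End.eigenspace _ _)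
    (fun h => hv0 (congrArg Subtype.val h)) fun w => ⟨w.1 0, Subtype.ext ?_⟩
  exact (hspan w.1 ((hmem _).1 w.2)).symm

/-! ### The main theorem -/

theorem mainTheorem1 (t : ℕ) (ht3 : 3 ≤ t) (htodd : Odd t)
    (ht10 : ¬ t ≡ 1 [MOD 10]) (ht18 : ¬ t ≡ 15 [MOD 18])
    (n : ℕ) [NeZero n] (hneven : Even n) (hn : 4 * t + 4 ≤ n) :
    IsNutGraph (Circ n (almostConsecutive t)) := by
  have hS : ∀ s ∈ almostConsecutive t, 1 ≤ s ∧ 2 * s < n := fun s hs => by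
    rw [mem_almostConsecutive] at hs
    omega
  refine isNutGraph_circ (even_iff_two_dvd.1 hneven) hS ?_ fun z hzn hz hsum => ?_
  · have h := sum_almostConsecutive (z := (-1 : ℝ)) (by norm_num) (by omega : 1 ≤ t)
    rw [htodd.neg_one_pow] at h
    refine (mul_eq_zero.1 (h.trans ?_)).resolve_left ?_
    · norm_num [plusTerms, minusTerms]
    · norm_num
  · have hz0 : z ≠ 0 := by
      rintro rfl
      simp [NeZero.ne n] at hzn
    have h := sum_almostConsecutive hz0 (by omega : 1 ≤ t)
    rw [hsum, mul_zero] at h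
    have hprim := IsPrimitiveRoot.orderOf z
    have hm0 : 0 < orderOf z := orderOf_pos_iff.2 (isOfFinOrder_iff_pow_eq_one.2
      ⟨n, Nat.pos_of_ne_zero (NeZero.ne n), hzn⟩)
    -- At z = 1 the factor z - 1 makes the closed form useless; the sum itself is 2|S| > 0.
    have h1 : orderOf z ≠ 1 := by
      rw [Ne, orderOf_eq_one_iff]
      rintro rfl
      have hpos : (almostConsecutive t).Nonempty := ⟨1, by rw [mem_almostConsecutive]; omega⟩
      simp at hsum
      exact hpos.ne_empty hsum
    have h2 : orderOf z ≠ 2 := fun h2 => by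
      have := pow_orderOf_eq_one z
      rw [h2] at this
      obtain rfl | rfl := eq_or_eq_neg_of_sq_eq_sq z 1 (by rw [this, one_pow])
      · simp at h1
      · exact hz rfl
    have hmain := hprim.eq_of_plusTerms_eq_minusTerms (t := t) (by omega)
      (sub_eq_zero.1 h.symm)
    have ho : t % 2 = 1 := Nat.odd_iff.1 htodd
    simp only [Nat.ModEq] at ht10 ht18
    -- As t is odd, t ≡ 6 mod 9 means t ≡ 15 mod 18.
    rcases hmain with ⟨h9, h6⟩ | ⟨h10, h11⟩
    · rw [h9] at h6
      omega
    · rw [h10] at h11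
      omega
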